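/- Let $n\ge 1$, $m\ge 1$, $0\le\gamma<1$, let $A_1,\dots,A_m$ be invertible real $n\times n$ matrices such that $A_k-A_{k'}$ is invertible for $k\ne k'$, and let $\gamma_1,\dots,\gamma_m>0$ satisfy $\gamma_1+\cdots+\gamma_m=n(1-\gamma)$. Put $$Tf(x)=\int_{\mathbb R^n}|x-A_1y|^{-\gamma_1}\cdots|x-A_my|^{-\gamma_m}f(y)\,dy .$$ All cubes are closed, of positive side length, with sides parallel to the axes; $|E|$ denotes the Lebesgue measure of $E$. For a cube $Q_0\subset\mathbb R^n$, $0<s\le 1/2$, a measurable $g:\mathbb R^n\to\mathbb R$ and $x\in Q_0$ let $$M^{\sharp}_{0,s,Q_0}g(x)=\sup_{x\in Q,\ Q\subset Q_0}\ \inf_{c'\in\mathbb R}\ \inf\{\alpha\ge 0:\ |\{y\in Q:|g(y)-c'|>\alpha\}|<s|Q|\},$$ the supremum being over cubes $Q$, and let $$M_\gamma f(x)=\sup_{Q\ni x}\frac1{|Q|^{1-\gamma}}\int_Q|f(y)|\,dy\in[0,\infty],$$ the supremum being over all cubes $Q\subset\mathbb R^n$ containing $x$. **Theorem 2.3.** For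 every $0<s\le 1/2$ there is a finite constant $c\ge 0$, depending only on $n,m,\gamma,s$, the $\gamma_i$ and the $A_i$, such that for every measurable $f:\mathbb R^n\to\mathbb R$ for which the integral defining $Tf(x)$ converges absolutely for almost every $x\in\mathbb R^n$, every cube $Q_0\subset\mathbb R^n$ and every $x\in Q_0$, $$M^{\sharp}_{0,s,Q_0}(Tf)(x)\le c\sum_{i=1}^m\ \sup_{x\in Q,\ Q\subset Q_0}\ \inf_{y\in Q}M_\gamma f(A_i^{-1}y).$$ -/

import Mathlib

open MeasureTheory
open scoped ENNReal NNReal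

namespace FracHom

/-- A (closed, nondegenerate) cube of `ℝⁿ` with sides parallel to the axes. -/
def IsCube {n : ℕ} (Q : Set (EuclideanSpace ℝ (Fin n))) : Prop :=
  ∃ (a : EuclideanSpace ℝ (Fin n)) (l : ℝ), 0 < l ∧
    Q = {y | ∀ j, a j ≤ y j ∧ y j ≤ a j + l}

/-- The local mean oscillation of `g` on `Q` with parameter `s`:
`inf_c inf {α ≥ 0 : |{y ∈ Q : |g y - c| > α}| < s |Q|}`. -/
noncomputable def medianOsc {n : ℕ} (s : ℝ) (g : EuclideanSpace ℝ (Fin n) → ℝ)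
    (Q : Set (EuclideanSpace ℝ (Fin n))) : ℝ≥0∞ :=
  ⨅ (c : ℝ) (α : ℝ≥0)
    (_ : volume {y | y ∈ Q ∧ (α : ℝ) < |g y - c|} < ENNReal.ofReal s * volume Q), (α : ℝ≥0∞)

/-- The local sharp maximal function of `g` restricted to the cube `Q₀`. -/
noncomputable def localSharp {n : ℕ} (s : ℝ) (Q₀ : Set (EuclideanSpace ℝ (Fin n)))
    (g : EuclideanSpace ℝ (Fin n) → ℝ) (x : EuclideanSpace ℝ (Fin n)) : ℝ≥0∞ :=
  ⨆ (Q : Set (EuclideanSpace ℝ (Fin n))) (_ : IsCube Q) (_ : x ∈ Q) (_ : Q ⊆ Q₀),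
    medianOsc s g Q

/-- The fractional maximal function `sup_{Q ∋ x} |Q|^{γ - 1} ∫_Q |f|`, with values in `[0, ∞]`. -/
noncomputable def fracMax {n : ℕ} (γ : ℝ) (f : EuclideanSpace ℝ (Fin n) → ℝ)
    (x : EuclideanSpace ℝ (Fin n)) : ℝ≥0∞ :=
  ⨆ (Q : Set (EuclideanSpace ℝ (Fin n))) (_ : IsCube Q) (_ : x ∈ Q),
    (volume Q) ^ (γ - 1) * ∫⁻ y in Q, ‖f y‖ₑ

/-- The kernel `∏ᵢ |x - Aᵢ y|^{-γᵢ}`. -/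
noncomputable def homKernel {n m : ℕ} (A : Fin m → Matrix (Fin n) (Fin n) ℝ) (γs : Fin m → ℝ)
    (x y : EuclideanSpace ℝ (Fin n)) : ℝ :=
  ∏ i, ‖x - Matrix.toEuclideanLin (A i) y‖ ^ (-γs i)

/-- The integral operator with kernel `homKernel A γs`. -/
noncomputable def homOp {n m : ℕ} (A : Fin m → Matrix (Fin n) (Fin n) ℝ) (γs : Fin m → ℝ)
    (f : EuclideanSpace ℝ (Fin n) → ℝ) (x : EuclideanSpace ℝ (Fin n)) : ℝ :=
  ∫ y, homKernel A γs x y * f y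

end FracHom

/-! Only one cube `Q` of side `l` matters: it suffices to bound the oscillation of `Tf` on `Q` by a
multiple of `X = ∑ i, inf_Q M_γ f(A_i⁻¹ ·)`. Write `N = ∑ γ_i = n(1 - γ)` and `R = √n l`. Fix `x₀ ∈
Q` where the integral converges, and split the `y`-space into the near set `S`, where some `A_i y`
is within `2R` of `x₀`, and its complement. The constant subtracted from `Tf` is the far integral
frozen at `x₀`.

Far part: moving `x₀` to `x ∈ Q` changes the kernel by at most `C R ∑ |x₀ - A_i y|^(-N-1)`
(`abs_prod_rpow_sub_le`). The extra power of the distance makes the dyadic sum in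
`lintegral_rpow_tail_le` converge, which gives a pointwise bound by `C X`.

Near part: only a weak-type bound is needed, so Tonelli and Markov reduce it to bounding the
integral of the kernel over `x ∈ Q` by `C l^(n-N)`, uniformly in `y`. This can fail near the origin,
where all the `A_i y` coalesce and the singularities add up to `|x|^(-N)`, not integrable when `γ =
0`. But the oscillation ignores small portions of `Q`, so a ball of radius `s l / 8` about the
origin is discarded. Outside it, invertibility of `A_i - A_j` lets at most one `A_i y` be close to
`x`, so the kernel is dominated by a sum of single powers `|x - A_i y|^(-γ_i)`
(`lintegral_homKernel_le`), integrable if `γ_i < n`.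

The remaining case `γ_i = n` forces `m = 1` and `γ = 0`. There, convergence almost everywhere
already makes `f` vanish almost everywhere, by Lebesgue differentiation. -/

namespace FracHom

/-! ### Cubes -/

/-- The closed cube with lower corner `a` and side `l`. -/
abbrev cube {n : ℕ} (a : EuclideanSpace ℝ (Fin n)) (l : ℝ) : Set (EuclideanSpace ℝ (Fin n)) :=
  {y | ∀ j, a j ≤ y j ∧ y j ≤ a j + l}

theorem volume_cube {n : ℕ} (a : EuclideanSpace ℝ (Fin n)) {l : ℝ} (hl : 0 ≤ l) :
    volume (cube a l) =
      ENNReal.ofReal (l ^ n) := by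
  have h : cube a l =
      (@WithLp.ofLp 2 (Fin n → ℝ)) ⁻¹' (Set.Icc (fun j => a j) (fun j => a j + l)) := by
    ext y
    simp [Pi.le_def, forall_and]
  rw [h, (PiLp.volume_preserving_ofLp (Fin n)).measure_preimage
    measurableSet_Icc.nullMeasurableSet, Real.volume_Icc_pi]
  simp [ENNReal.ofReal_pow hl]

theorem measurableSet_cube {n : ℕ} (a : EuclideanSpace ℝ (Fin n)) (l : ℝ) :
    MeasurableSet (cube a l) := by
  measurability

theorem norm_sub_le_of_mem_cube {n : ℕ} {a x y : EuclideanSpace ℝ (Fin n)} {l : ℝ} (hl : 0 ≤ l)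
    (hx : x ∈ cube a l) (hy : y ∈ cube a l) :
    ‖x - y‖ ≤ √n * l := by
  rw [EuclideanSpace.norm_eq]
  have h : ∑ i, ‖(x - y) i‖ ^ 2 ≤ n * l ^ 2 := by
    calc ∑ i, ‖(x - y) i‖ ^ 2 ≤ ∑ _i : Fin n, l ^ 2 := by
          refine Finset.sum_le_sum fun i _ => ?_
          have h1 := hx i
          have h2 := hy i
          have h3 : ‖(x - y) i‖ ≤ l := by
            rw [PiLp.sub_apply, Real.norm_eq_abs, abs_le]
            constructor <;> linarith
          gcongr
      _ = n * l ^ 2 := by simp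
  calc √(∑ i, ‖(x - y) i‖ ^ 2) ≤ √(n * l ^ 2) := Real.sqrt_le_sqrt h
    _ = √n * l := by rw [Real.sqrt_mul (by positivity), Real.sqrt_sq hl]

/-- The cube with centre `b` and side `2 * r`. -/
def centredCube {n : ℕ} (b : EuclideanSpace ℝ (Fin n)) (r : ℝ) :
    Set (EuclideanSpace ℝ (Fin n)) :=
  cube (WithLp.toLp 2 fun j => b j - r) (2 * r)

theorem isCube_centredCube {n : ℕ} (b : EuclideanSpace ℝ (Fin n)) {r : ℝ} (hr : 0 < r) :
    IsCube (centredCube b r) :=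
  ⟨_, 2 * r, by positivity, rfl⟩

theorem volume_centredCube {n : ℕ} (b : EuclideanSpace ℝ (Fin n)) {r : ℝ} (hr : 0 ≤ r) :
    volume (centredCube b r) = ENNReal.ofReal ((2 * r) ^ n) :=
  volume_cube _ (by positivity)

theorem mem_centredCube_of_norm_sub_le {n : ℕ} {b y : EuclideanSpace ℝ (Fin n)} {r : ℝ}
    (h : ‖y - b‖ ≤ r) : y ∈ centredCube b r := by
  intro j
  have h1 : ‖(y - b) j‖ ≤ r := (PiLp.norm_apply_le (y - b) j).trans h
  rw [PiLp.sub_apply, Real.norm_eq_abs, abs_le] at h1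
  constructor <;> simp only <;> linarith [h1.1, h1.2]

theorem volume_ball_le {n : ℕ} (b : EuclideanSpace ℝ (Fin n)) {r : ℝ} (hr : 0 ≤ r) :
    volume {y | ‖y - b‖ < r} ≤ ENNReal.ofReal ((2 * r) ^ n) := by
  rw [← volume_centredCube b hr]
  exact measure_mono fun y hy => mem_centredCube_of_norm_sub_le (le_of_lt hy)

/-- The integral of `|f|` over a set contained in a ball is controlled by the fractional
maximal function at every point of that ball. -/
theorem setLIntegral_le_fracMax {n : ℕ} (γ : ℝ)
    (f : EuclideanSpace ℝ (Fin n) → ℝ) {S : Set (EuclideanSpace ℝ (Fin n))}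
    {b z : EuclideanSpace ℝ (Fin n)} {r : ℝ} (hr : 0 < r)
    (hS : ∀ y ∈ S, ‖y - b‖ ≤ r) (hz : ‖z - b‖ ≤ r) :
    ∫⁻ y in S, ‖f y‖ₑ ≤ ENNReal.ofReal ((2 * r) ^ (n * (1 - γ))) * fracMax γ f z := by
  have h1 : ∫⁻ y in S, ‖f y‖ₑ ≤ ∫⁻ y in centredCube b r, ‖f y‖ₑ :=
    lintegral_mono_set fun y hy => mem_centredCube_of_norm_sub_le (hS y hy)
  have h2 : (volume (centredCube b r)) ^ (γ - 1) * ∫⁻ y in centredCube b r, ‖f y‖ₑ ≤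
      fracMax γ f z :=
    le_iSup₂_of_le (centredCube b r) (isCube_centredCube b hr)
      (le_iSup_of_le (mem_centredCube_of_norm_sub_le hz) le_rfl)
  have hr2 : (0 : ℝ) < (2 * r) ^ n := by positivity
  rw [volume_centredCube b hr.le, ENNReal.ofReal_rpow_of_pos hr2] at h2
  refine h1.trans ?_
  calc ∫⁻ y in centredCube b r, ‖f y‖ₑ
      = ENNReal.ofReal ((2 * r) ^ (n * (1 - γ))) * (ENNReal.ofReal (((2 * r) ^ n) ^ (γ - 1)) *
          ∫⁻ y in centredCube b r, ‖f y‖ₑ) := by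
        rw [← mul_assoc, ← ENNReal.ofReal_mul (by positivity), ← Real.rpow_natCast,
          ← Real.rpow_mul (by positivity), ← Real.rpow_add (by positivity)]
        have : (n : ℝ) * (1 - γ) + n * (γ - 1) = 0 := by ring
        simp [this]
    _ ≤ _ := by gcongr

/-! ### Powers of the norm -/

theorem lintegral_ball_rpow {n : ℕ} (hn : 0 < n) {g : ℝ} (hg : g < n) :
    ∃ C : ℝ≥0, ∀ (b : EuclideanSpace ℝ (Fin n)) (l : ℝ), 0 < l →
      ∫⁻ x in {x | ‖x - b‖ < l}, ENNReal.ofReal (‖x - b‖ ^ (-g)) ≤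
        C * ENNReal.ofReal (l ^ (n - g)) := by
  have : Nonempty (Fin n) := ⟨⟨0, hn⟩⟩
  have hint : IntegrableOn (fun x : EuclideanSpace ℝ (Fin n) => ‖x‖ ^ (-g))
      (Metric.ball 0 1) volume := by
    refine (integrableOn_fun_norm_addHaar volume (f := fun t => t ^ (-g))).2 ?_
    have h1 : IntegrableOn (fun t : ℝ => t ^ ((n : ℝ) - 1 - g)) (Set.Ioo 0 1) :=
      (intervalIntegral.integrableOn_Ioo_rpow_iff one_pos).2 (by linarith)
    refine h1.congr_fun (fun t ht => ?_) measurableSet_Ioo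
    simp only [finrank_euclideanSpace, Fintype.card_fin, smul_eq_mul]
    rw [sub_eq_add_neg, Real.rpow_add ht.1, ← Nat.cast_one, ← Nat.cast_sub hn, Real.rpow_natCast]
  have hfin : ∫⁻ x in Metric.ball (0 : EuclideanSpace ℝ (Fin n)) 1,
      ENNReal.ofReal (‖x‖ ^ (-g)) < ∞ :=
    (hasFiniteIntegral_iff_ofReal (ae_of_all _ fun x => by positivity)).1 hint.2
  refine ⟨(∫⁻ x in Metric.ball (0 : EuclideanSpace ℝ (Fin n)) 1,
      ENNReal.ofReal (‖x‖ ^ (-g))).toNNReal, fun b l hl => ?_⟩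
  rw [ENNReal.coe_toNNReal hfin.ne]
  let G : EuclideanSpace ℝ (Fin n) → ℝ≥0∞ :=
    (Metric.ball 0 l).indicator fun x => ENNReal.ofReal (‖x‖ ^ (-g))
  have hG : Measurable G :=
    Measurable.indicator (by fun_prop) measurableSet_ball
  have hset : {x : EuclideanSpace ℝ (Fin n) | ‖x - b‖ < l} = Metric.ball b l := by
    ext x; simp [dist_eq_norm]
  have e1 : ∫⁻ x in {x | ‖x - b‖ < l}, ENNReal.ofReal (‖x - b‖ ^ (-g)) = ∫⁻ x, G x := by
    rw [hset, ← lintegral_indicator measurableSet_ball, ← lintegral_sub_right_eq_self G b]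
    refine lintegral_congr fun x => ?_
    classical
    simp only [G, Set.indicator_apply, Metric.mem_ball, dist_eq_norm, sub_zero]
  -- The same integral is computed twice: by change of variables here, by homogeneity of the norm in
  -- `e3`.
  have e2 : ∫⁻ x, G (l • x) = ENNReal.ofReal ((l ^ n)⁻¹) * ∫⁻ x, G x := by
    rw [← lintegral_map (f := G) (g := fun x => l • x) hG (by fun_prop),
      Measure.map_addHaar_smul volume hl.ne', lintegral_smul_measure, finrank_euclideanSpace,
      Fintype.card_fin, abs_of_pos (by positivity), smul_eq_mul]
  have e3 : ∫⁻ x, G (l • x) = ENNReal.ofReal (l ^ (-g)) *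
      ∫⁻ x in Metric.ball (0 : EuclideanSpace ℝ (Fin n)) 1, ENNReal.ofReal (‖x‖ ^ (-g)) := by
    rw [← lintegral_indicator measurableSet_ball, ← lintegral_const_mul' _ _ (by simp)]
    refine lintegral_congr fun x => ?_
    classical
    have hl1 : l * ‖x‖ < l ↔ ‖x‖ < 1 := by
      constructor <;> intro h <;> nlinarith
    simp only [G, Set.indicator_apply, Metric.mem_ball, dist_zero_right, norm_smul,
      Real.norm_eq_abs, abs_of_pos hl, hl1]
    split_ifs
    · rw [Real.mul_rpow hl.le (norm_nonneg _), ENNReal.ofReal_mul (by positivity)]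
    · simp
  rw [e1]
  refine le_of_eq ?_
  calc ∫⁻ x, G x = ENNReal.ofReal (l ^ n) * (ENNReal.ofReal ((l ^ n)⁻¹) * ∫⁻ x, G x) := by
        rw [← mul_assoc, ← ENNReal.ofReal_mul (by positivity), mul_inv_cancel₀ (by positivity)]
        simp
    _ = _ := by
        rw [← e2, e3, ← mul_assoc, ← ENNReal.ofReal_mul (by positivity), mul_comm,
          ← Real.rpow_natCast, ← Real.rpow_add hl, ← sub_eq_add_neg]

/-- The pole `b` may lie anywhere: within distance `l` of it the ball estimate applies, and beyond
that the integrand is at most `l ^ (-g)`. -/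
theorem lintegral_cube_rpow {n : ℕ} (hn : 0 < n) {g : ℝ} (hg0 : 0 ≤ g) (hg : g < n) :
    ∃ C : ℝ≥0, ∀ (a b : EuclideanSpace ℝ (Fin n)) (l : ℝ), 0 < l →
      ∫⁻ x in cube a l, ENNReal.ofReal (‖x - b‖ ^ (-g)) ≤
        C * ENNReal.ofReal (l ^ (n - g)) := by
  obtain ⟨C, hC⟩ := lintegral_ball_rpow hn hg
  refine ⟨C + 1, fun a b l hl => ?_⟩
  have h0 : ∫⁻ x in cube a l, ENNReal.ofReal (l ^ (-g)) =
      ENNReal.ofReal (l ^ (n - g)) := by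
    rw [setLIntegral_const, volume_cube a hl.le, ← ENNReal.ofReal_mul (by positivity),
      ← Real.rpow_natCast, ← Real.rpow_add hl, neg_add_eq_sub]
  have hb : MeasurableSet {x : EuclideanSpace ℝ (Fin n) | ‖x - b‖ < l} :=
    measurableSet_lt (by fun_prop) (by fun_prop)
  calc ∫⁻ x in cube a l, ENNReal.ofReal (‖x - b‖ ^ (-g))
      ≤ ∫⁻ x in cube a l,
          ({x | ‖x - b‖ < l}.indicator (fun x => ENNReal.ofReal (‖x - b‖ ^ (-g))) x +
            ENNReal.ofReal (l ^ (-g))) := by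
        refine lintegral_mono fun x => ?_
        classical
        by_cases hx : ‖x - b‖ < l
        · simp [hx]
        · simp only [Set.indicator_apply, Set.mem_ofPred_eq, hx, if_false, zero_add]
          exact ENNReal.ofReal_le_ofReal
            (Real.rpow_le_rpow_of_nonpos hl (not_lt.1 hx) (by linarith))
    _ = (∫⁻ x in cube a l,
          {x | ‖x - b‖ < l}.indicator (fun x => ENNReal.ofReal (‖x - b‖ ^ (-g))) x) +
            ENNReal.ofReal (l ^ (n - g)) := by
        rw [lintegral_add_right _ measurable_const, h0]
    _ ≤ (∫⁻ x, {x | ‖x - b‖ < l}.indicator (fun x => ENNReal.ofReal (‖x - b‖ ^ (-g))) x) +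
            ENNReal.ofReal (l ^ (n - g)) := by
        gcongr
        exact Measure.restrict_le_self
    _ ≤ C * ENNReal.ofReal (l ^ (n - g)) + ENNReal.ofReal (l ^ (n - g)) := by
        rw [lintegral_indicator hb]
        gcongr
        exact hC b l hl
    _ = _ := by push_cast; ring

/-! ### Bounds for matrices -/

theorem exists_norm_toEuclideanLin_le {ι : Type*} [Finite ι] {n : ℕ}
    (M : ι → Matrix (Fin n) (Fin n) ℝ) :
    ∃ B : ℝ, 0 < B ∧ ∀ i y, ‖Matrix.toEuclideanLin (M i) y‖ ≤ B * ‖y‖ := by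
  have := Fintype.ofFinite ι
  refine ⟨1 + ∑ i, ‖(Matrix.toEuclideanLin (M i)).toContinuousLinearMap‖, by positivity,
    fun i y => ?_⟩
  have h1 := (Matrix.toEuclideanLin (M i)).toContinuousLinearMap.le_opNorm y
  have h2 := Finset.single_le_sum
    (f := fun i => ‖(Matrix.toEuclideanLin (M i)).toContinuousLinearMap‖)
    (fun i _ => norm_nonneg _) (Finset.mem_univ i)
  refine h1.trans ?_
  gcongr
  simp only at h2
  linarith

theorem toEuclideanLin_mul_apply {n : ℕ} (M N : Matrix (Fin n) (Fin n) ℝ)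
    (y : EuclideanSpace ℝ (Fin n)) :
    Matrix.toEuclideanLin M (Matrix.toEuclideanLin N y) = Matrix.toEuclideanLin (M * N) y := by
  simp [Matrix.toLpLin_apply]

theorem toEuclideanLin_inv_apply_self {n : ℕ} {M : Matrix (Fin n) (Fin n) ℝ} (hM : IsUnit M)
    (y : EuclideanSpace ℝ (Fin n)) :
    Matrix.toEuclideanLin M⁻¹ (Matrix.toEuclideanLin M y) = y := by
  rw [toEuclideanLin_mul_apply, Matrix.nonsing_inv_mul _ ((Matrix.isUnit_iff_isUnit_det M).1 hM)]
  simp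

theorem continuous_toEuclideanLin {n : ℕ} (M : Matrix (Fin n) (Fin n) ℝ) :
    Continuous fun y : EuclideanSpace ℝ (Fin n) => Matrix.toEuclideanLin M y :=
  LinearMap.continuous_of_finiteDimensional _

/-! ### Products of powers -/

/-- At most one factor has a base below `δ`, and the others are bounded by powers of `δ`. Summing
over all candidates removes the dependence on which index is exceptional. -/
theorem prod_rpow_le_sum {ι : Type*} [Fintype ι] [Nonempty ι] {d g : ι → ℝ}
    (hd : ∀ i, 0 ≤ d i) (hg : ∀ i, 0 ≤ g i) {δ : ℝ} (hδ : 0 < δ)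
    (hsep : ∀ i j, i ≠ j → δ ≤ d i ∨ δ ≤ d j) :
    ∏ i, d i ^ (-g i) ≤ ∑ i, δ ^ (-((∑ j, g j) - g i)) * d i ^ (-g i) := by
  classical
  obtain ⟨k, hk⟩ : ∃ k, ∀ j, j ≠ k → δ ≤ d j := by
    by_cases h : ∃ k, d k < δ
    · obtain ⟨k, hk⟩ := h
      exact ⟨k, fun j hj => (hsep j k hj).resolve_right (not_le.2 hk)⟩
    · push Not at h
      exact ⟨Classical.arbitrary ι, fun j _ => h j⟩
  have hprod : ∏ i ∈ Finset.univ.erase k, d i ^ (-g i) ≤ δ ^ (-((∑ j, g j) - g k)) := by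
    calc ∏ i ∈ Finset.univ.erase k, d i ^ (-g i)
        ≤ ∏ i ∈ Finset.univ.erase k, δ ^ (-g i) :=
          Finset.prod_le_prod (fun i _ => Real.rpow_nonneg (hd i) _) fun i hi =>
            Real.rpow_le_rpow_of_nonpos hδ (hk i (Finset.ne_of_mem_erase hi))
              (neg_nonpos.2 (hg i))
      _ = _ := by
          rw [← Real.rpow_sum_of_pos hδ, Finset.sum_neg_distrib,
            ← Finset.add_sum_erase _ _ (Finset.mem_univ k)]
          congr 1
          ring
  calc ∏ i, d i ^ (-g i) = d k ^ (-g k) * ∏ i ∈ Finset.univ.erase k, d i ^ (-g i) :=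
        (Finset.mul_prod_erase _ _ (Finset.mem_univ k)).symm
    _ ≤ d k ^ (-g k) * δ ^ (-((∑ j, g j) - g k)) :=
        mul_le_mul_of_nonneg_left hprod (Real.rpow_nonneg (hd k) _)
    _ = δ ^ (-((∑ j, g j) - g k)) * d k ^ (-g k) := mul_comm _ _
    _ ≤ _ := Finset.single_le_sum (f := fun i => δ ^ (-((∑ j, g j) - g i)) * d i ^ (-g i))
        (fun i _ => mul_nonneg (by positivity) (Real.rpow_nonneg (hd i) _)) (Finset.mem_univ k)

theorem abs_exp_sub_one_le_mul_exp {w u : ℝ} (hw : |w| ≤ u) :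
    |Real.exp w - 1| ≤ u * Real.exp u := by
  have hu : 0 ≤ u := (abs_nonneg w).trans hw
  obtain ⟨h1, h2⟩ := abs_le.1 hw
  have he : 1 ≤ Real.exp u := Real.one_le_exp hu
  have h3 : (1 - w) * Real.exp w ≤ 1 := by
    have h := Real.add_one_le_exp (-w)
    calc (1 - w) * Real.exp w ≤ Real.exp (-w) * Real.exp w := by gcongr; linarith
      _ = 1 := by rw [← Real.exp_add]; simp
  have h4 : w * Real.exp w ≤ u * Real.exp u := by
    calc w * Real.exp w ≤ u * Real.exp w := by gcongr
      _ ≤ u * Real.exp u := by gcongr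
  have h5 := Real.add_one_le_exp w
  rw [abs_le]
  constructor <;> nlinarith

/-- Apply `1 - 1/t ≤ log t ≤ t - 1` at `t = e / d`; the factor 2 comes from `e ≥ d / 2`. -/
theorem abs_log_div_le {d e R : ℝ} (hR : 0 < R) (hd : 2 * R ≤ d) (hde : |e - d| ≤ R) :
    |Real.log (e / d)| ≤ 2 * R / d := by
  have hd0 : 0 < d := by linarith
  obtain ⟨h1, h2⟩ := abs_le.1 hde
  have he0 : 0 < e := by linarith
  have ht : 0 < e / d := by positivity
  have h3 := Real.log_le_sub_one_of_pos ht
  have h4 := Real.one_sub_inv_le_log_of_pos ht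
  have h5 : e / d - 1 ≤ 2 * R / d := by
    rw [div_sub_one hd0.ne']
    gcongr
    linarith
  have h6 : -(2 * R / d) ≤ 1 - (e / d)⁻¹ := by
    rw [inv_div, one_sub_div he0.ne', ← neg_div, div_le_div_iff₀ hd0 he0]
    nlinarith
  rw [abs_le]
  constructor <;> linarith

/-- Products of negative powers of comparable quantities differ little. -/
theorem abs_prod_rpow_sub_le {ι : Type*} [Fintype ι] [Nonempty ι] {d e g : ι → ℝ}
    (hg : ∀ i, 0 ≤ g i) {R : ℝ} (hR : 0 < R) (hd : ∀ i, 2 * R ≤ d i)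
    (hde : ∀ i, |e i - d i| ≤ R) :
    |∏ i, e i ^ (-g i) - ∏ i, d i ^ (-g i)| ≤
      2 * (∑ i, g i) * Real.exp (∑ i, g i) * R * ∑ i, d i ^ (-((∑ j, g j) + 1)) := by
  set N := ∑ i, g i with hN
  have hN0 : 0 ≤ N := Finset.sum_nonneg fun i _ => hg i
  obtain ⟨k, hk⟩ := Finite.exists_min d
  have hd0 : ∀ i, 0 < d i := fun i => by linarith [hd i]
  have he0 : ∀ i, 0 < e i := fun i => by linarith [hd i, (abs_le.1 (hde i)).1]
  -- The ratio of the two products is `exp w`, and `|w|` is at most `N * (2R / d k)` with `d k` the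
  -- smallest distance.
  set w := ∑ i, -g i * Real.log (e i / d i) with hw
  have hfac : ∏ i, e i ^ (-g i) = (∏ i, d i ^ (-g i)) * Real.exp w := by
    rw [hw, Real.exp_sum, ← Finset.prod_mul_distrib]
    refine Finset.prod_congr rfl fun i _ => ?_
    rw [mul_comm (-g i), ← Real.rpow_def_of_pos (div_pos (he0 i) (hd0 i)),
      ← Real.mul_rpow (hd0 i).le (div_pos (he0 i) (hd0 i)).le, mul_div_cancel₀ _ (hd0 i).ne']
  have hwle : |w| ≤ N * (2 * R / d k) := by
    calc |w| ≤ ∑ i, |(-g i) * Real.log (e i / d i)| := Finset.abs_sum_le_sum_abs _ _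
      _ ≤ ∑ i, g i * (2 * R / d k) := by
          refine Finset.sum_le_sum fun i _ => ?_
          rw [abs_mul, abs_neg, abs_of_nonneg (hg i)]
          refine mul_le_mul_of_nonneg_left ((abs_log_div_le hR (hd i) (hde i)).trans ?_) (hg i)
          exact div_le_div_of_nonneg_left (by positivity) (hd0 k) (hk i)
      _ = _ := by rw [← Finset.sum_mul]
  have hu1 : N * (2 * R / d k) ≤ N := by
    refine mul_le_of_le_one_right hN0 ((div_le_one (hd0 k)).2 (hd k))
  have hexp : |Real.exp w - 1| ≤ N * (2 * R / d k) * Real.exp N := by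
    refine (abs_exp_sub_one_le_mul_exp hwle).trans ?_
    have := (hd0 k).le
    gcongr
  have hP : ∏ i, d i ^ (-g i) ≤ d k ^ (-N) := by
    calc ∏ i, d i ^ (-g i) ≤ ∏ i, d k ^ (-g i) :=
          Finset.prod_le_prod (fun i _ => Real.rpow_nonneg (hd0 i).le _) fun i _ =>
            Real.rpow_le_rpow_of_nonpos (hd0 k) (hk i) (neg_nonpos.2 (hg i))
      _ = _ := by rw [← Real.rpow_sum_of_pos (hd0 k), Finset.sum_neg_distrib]
  have hP0 : 0 ≤ ∏ i, d i ^ (-g i) := Finset.prod_nonneg fun i _ => Real.rpow_nonneg (hd0 i).le _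
  calc |∏ i, e i ^ (-g i) - ∏ i, d i ^ (-g i)|
      = (∏ i, d i ^ (-g i)) * |Real.exp w - 1| := by
        rw [hfac, ← mul_sub_one, abs_mul, abs_of_nonneg hP0]
    _ ≤ d k ^ (-N) * (N * (2 * R / d k) * Real.exp N) := by
        have := (hd0 k).le
        gcongr
    _ = 2 * N * Real.exp N * R * d k ^ (-(N + 1)) := by
        rw [neg_add, Real.rpow_add (hd0 k), Real.rpow_neg_one]
        ring
    _ ≤ _ := by
        gcongr
        exact Finset.single_le_sum (f := fun i => d i ^ (-(N + 1)))
          (fun i _ => Real.rpow_nonneg (hd0 i).le _) (Finset.mem_univ k)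

/-! ### A dyadic tail estimate -/

/-- On the shell `2^k r ≤ d < 2^(k+1) r` the growth `ρ^N` beats all but one power of the weight,
leaving `2^N r⁻¹ 2^(-k)`; the geometric series supplies one more factor 2. -/
theorem lintegral_rpow_tail_le {α : Type*} [MeasurableSpace α] {μ : Measure α} {d : α → ℝ}
    (hd : Measurable d) {h : α → ℝ≥0∞} (hh : AEMeasurable h μ) {N r : ℝ} (hN : 0 ≤ N)
    (hr : 0 < r) {X : ℝ≥0∞}
    (H : ∀ ρ, r ≤ ρ → ∫⁻ y in {y | d y < ρ}, h y ∂μ ≤ ENNReal.ofReal (ρ ^ N) * X) :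
    ∫⁻ y in {y | r ≤ d y}, ENNReal.ofReal (d y ^ (-(N + 1))) * h y ∂μ ≤
      ENNReal.ofReal (2 ^ (N + 1) * r⁻¹) * X := by
  have hms : ∀ ρ, MeasurableSet {y | d y < ρ} := fun ρ => measurableSet_lt hd measurable_const
  have hms' : MeasurableSet {y | r ≤ d y} := measurableSet_le measurable_const hd
  let F : ℕ → α → ℝ≥0∞ := fun k y =>
    ENNReal.ofReal ((2 ^ k * r) ^ (-(N + 1))) * {y | d y < 2 ^ (k + 1) * r}.indicator h y
  have hF : ∀ k, AEMeasurable (F k) μ := fun k => (hh.indicator (hms _)).const_mul _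
  have hpt : ∀ y, {y | r ≤ d y}.indicator
      (fun y => ENNReal.ofReal (d y ^ (-(N + 1))) * h y) y ≤ ∑' k, F k y := by
    intro y
    by_cases hy : r ≤ d y
    · obtain ⟨k, hk1, hk2⟩ := exists_nat_pow_near ((one_le_div hr).2 hy) one_lt_two
      rw [le_div_iff₀ hr] at hk1
      rw [div_lt_iff₀ hr] at hk2
      refine le_trans ?_ (ENNReal.le_tsum k)
      rw [Set.indicator_of_mem (by exact hy)]
      simp only [F]
      rw [Set.indicator_of_mem (by exact hk2)]
      exact mul_le_mul' (ENNReal.ofReal_le_ofReal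
        (Real.rpow_le_rpow_of_nonpos (by positivity) hk1 (by linarith))) le_rfl
    · rw [Set.indicator_of_notMem (by exact hy)]
      exact zero_le
  have hint : ∀ k, ∫⁻ y, F k y ∂μ ≤
      ENNReal.ofReal (2 ^ N * r⁻¹) * X * ENNReal.ofReal ((1 / 2) ^ k) := by
    intro k
    simp only [F]
    rw [lintegral_const_mul' _ _ (by simp), lintegral_indicator (hms _)]
    have hk : r ≤ 2 ^ (k + 1) * r := le_mul_of_one_le_left hr.le (one_le_pow₀ one_le_two)
    calc _ ≤ ENNReal.ofReal ((2 ^ k * r) ^ (-(N + 1))) *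
          (ENNReal.ofReal ((2 ^ (k + 1) * r) ^ N) * X) := by gcongr; exact H _ hk
      _ = ENNReal.ofReal (2 ^ N * r⁻¹ * (1 / 2) ^ k) * X := by
          rw [← mul_assoc, ← ENNReal.ofReal_mul (by positivity)]
          congr 2
          have hp : (0 : ℝ) < 2 ^ k * r := by positivity
          rw [show (2 : ℝ) ^ (k + 1) * r = 2 * (2 ^ k * r) by ring,
            Real.mul_rpow zero_le_two hp.le, neg_add, Real.rpow_add hp, Real.rpow_neg_one,
            Real.rpow_neg hp.le]
          have : (2 ^ k * r) ^ N ≠ 0 := by positivity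
          field_simp
          simp
      _ = _ := by
          rw [ENNReal.ofReal_mul (by positivity)]
          ring
  calc ∫⁻ y in {y | r ≤ d y}, ENNReal.ofReal (d y ^ (-(N + 1))) * h y ∂μ
      = ∫⁻ y, {y | r ≤ d y}.indicator
          (fun y => ENNReal.ofReal (d y ^ (-(N + 1))) * h y) y ∂μ :=
        (lintegral_indicator hms' _).symm
    _ ≤ ∫⁻ y, ∑' k, F k y ∂μ := lintegral_mono hpt
    _ = ∑' k, ∫⁻ y, F k y ∂μ := lintegral_tsum hF
    _ ≤ ∑' k, ENNReal.ofReal (2 ^ N * r⁻¹) * X * ENNReal.ofReal ((1 / 2) ^ k) :=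
        ENNReal.tsum_le_tsum hint
    _ = ENNReal.ofReal (2 ^ N * r⁻¹) * X * ENNReal.ofReal 2 := by
        rw [ENNReal.tsum_mul_left, ← ENNReal.ofReal_tsum_of_nonneg (fun k => by positivity)
          summable_geometric_two, tsum_geometric_two]
    _ = _ := by
        rw [Real.rpow_add_one two_ne_zero, show (2 : ℝ) ^ N * 2 * r⁻¹ = 2 ^ N * r⁻¹ * 2 by ring,
          ENNReal.ofReal_mul (p := 2 ^ N * r⁻¹) (by positivity)]
        ring

/-! ### The kernel -/

theorem homKernel_nonneg {n m : ℕ} (A : Fin m → Matrix (Fin n) (Fin n) ℝ) (γs : Fin m → ℝ)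
    (x y : EuclideanSpace ℝ (Fin n)) : 0 ≤ homKernel A γs x y :=
  Finset.prod_nonneg fun _ _ => Real.rpow_nonneg (norm_nonneg _) _

theorem measurable_norm_sub_toEuclideanLin {n : ℕ} (M : Matrix (Fin n) (Fin n) ℝ) :
    Measurable fun p : EuclideanSpace ℝ (Fin n) × EuclideanSpace ℝ (Fin n) =>
      ‖p.1 - Matrix.toEuclideanLin M p.2‖ :=
  (continuous_fst.sub ((continuous_toEuclideanLin M).comp continuous_snd)).norm.measurable

theorem measurable_homKernel {n m : ℕ} (A : Fin m → Matrix (Fin n) (Fin n) ℝ) (γs : Fin m → ℝ) :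
    Measurable fun p : EuclideanSpace ℝ (Fin n) × EuclideanSpace ℝ (Fin n) =>
      homKernel A γs p.1 p.2 :=
  Finset.measurable_prod _ fun i _ =>
    (measurable_norm_sub_toEuclideanLin (A i)).pow_const _

/-- Away from the origin, at most one of the points `A i y` can be close to `x`. -/
theorem exists_norm_sub_toEuclideanLin_sep {n m : ℕ} (A : Fin m → Matrix (Fin n) (Fin n) ℝ)
    (hAA : ∀ k k', k ≠ k' → IsUnit (A k - A k')) {ε : ℝ} (hε : 0 < ε) :
    ∃ κ : ℝ, 0 < κ ∧ ∀ (l : ℝ) (x y : EuclideanSpace ℝ (Fin n)), 0 < l → ε * l ≤ ‖x‖ →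
      ∀ i j, i ≠ j → κ * l ≤ ‖x - Matrix.toEuclideanLin (A i) y‖ ∨
        κ * l ≤ ‖x - Matrix.toEuclideanLin (A j) y‖ := by
  obtain ⟨B₁, hB₁, h₁⟩ := exists_norm_toEuclideanLin_le A
  obtain ⟨B₂, hB₂, h₂⟩ := exists_norm_toEuclideanLin_le
    (fun p : Fin m × Fin m => (A p.1 - A p.2)⁻¹)
  -- If both distances were below `κ l`, then `|(A i - A j) y| < 2κl`, so `|y| ≤ 2 B₂ κ l` and `|x|
  -- < κ l (1 + 2 B₁ B₂)`; this `κ` makes the last bound equal to `ε l`.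
  refine ⟨ε / (1 + 2 * B₁ * B₂), by positivity, fun l x y hl hx i j hij => ?_⟩
  by_contra! hcon
  obtain ⟨hi, hj⟩ := hcon
  set κ := ε / (1 + 2 * B₁ * B₂) with hκ
  have hκε : κ * (1 + 2 * B₁ * B₂) = ε := div_mul_cancel₀ _ (by positivity)
  have hy : ‖y‖ ≤ B₂ * (2 * (κ * l)) := by
    have e := h₂ (i, j) (Matrix.toEuclideanLin (A i - A j) y)
    rw [toEuclideanLin_inv_apply_self (hAA i j hij)] at e
    refine e.trans (mul_le_mul_of_nonneg_left ?_ hB₂.le)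
    have e2 : Matrix.toEuclideanLin (A i - A j) y =
        (x - Matrix.toEuclideanLin (A j) y) - (x - Matrix.toEuclideanLin (A i) y) := by
      rw [map_sub, LinearMap.sub_apply]
      abel
    rw [e2]
    refine (norm_sub_le _ _).trans ?_
    linarith
  have hx' : ‖x‖ < κ * l + B₁ * (B₂ * (2 * (κ * l))) := by
    calc ‖x‖ = ‖(x - Matrix.toEuclideanLin (A i) y) + Matrix.toEuclideanLin (A i) y‖ := by
          rw [sub_add_cancel]
      _ ≤ ‖x - Matrix.toEuclideanLin (A i) y‖ + ‖Matrix.toEuclideanLin (A i) y‖ := norm_add_le _ _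
      _ < κ * l + B₁ * (B₂ * (2 * (κ * l))) :=
          add_lt_add_of_lt_of_le hi ((h₁ i y).trans (mul_le_mul_of_nonneg_left hy hB₁.le))
  have : κ * l + B₁ * (B₂ * (2 * (κ * l))) = ε * l := by
    rw [← hκε]; ring
  linarith

/-- Away from a small neighbourhood of the origin, the kernel is integrable in `x` over a cube
with a bound independent of `y`. -/
theorem lintegral_homKernel_le {n m : ℕ} (hn : 0 < n) (hm : 0 < m)
    (A : Fin m → Matrix (Fin n) (Fin n) ℝ)
    (hAA : ∀ k k', k ≠ k' → IsUnit (A k - A k')) (γs : Fin m → ℝ) (hγs : ∀ i, 0 ≤ γs i)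
    (hγn : ∀ i, γs i < n) {ε : ℝ} (hε : 0 < ε) :
    ∃ C : ℝ≥0, ∀ (a y : EuclideanSpace ℝ (Fin n)) (l : ℝ), 0 < l →
      ∫⁻ x in cube a l ∩ {x | ε * l ≤ ‖x‖}, ENNReal.ofReal (homKernel A γs x y) ≤
        C * ENNReal.ofReal (l ^ (n - ∑ i, γs i)) := by
  have : Nonempty (Fin m) := ⟨⟨0, hm⟩⟩
  obtain ⟨κ, hκ, hsep⟩ := exists_norm_sub_toEuclideanLin_sep A hAA hε
  choose C hC using fun i => lintegral_cube_rpow hn (hγs i) (hγn i)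
  set N := ∑ i, γs i with hN
  refine ⟨∑ i, (κ ^ (-(N - γs i))).toNNReal * C i, fun a y l hl => ?_⟩
  have hms : MeasurableSet {x : EuclideanSpace ℝ (Fin n) | ε * l ≤ ‖x‖} :=
    measurableSet_le measurable_const measurable_norm
  calc ∫⁻ x in cube a l ∩ {x | ε * l ≤ ‖x‖}, ENNReal.ofReal (homKernel A γs x y)
      ≤ ∫⁻ x in cube a l ∩ {x | ε * l ≤ ‖x‖}, ∑ i, ENNReal.ofReal ((κ * l) ^ (-(N - γs i))) *
          ENNReal.ofReal (‖x - Matrix.toEuclideanLin (A i) y‖ ^ (-γs i)) := by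
        refine setLIntegral_mono' ((measurableSet_cube a l).inter hms) fun x hx => ?_
        have h := prod_rpow_le_sum (d := fun i => ‖x - Matrix.toEuclideanLin (A i) y‖)
          (fun i => norm_nonneg _) hγs (mul_pos hκ hl) (hsep l x y hl hx.2)
        refine (ENNReal.ofReal_le_ofReal h).trans (le_of_eq ?_)
        rw [ENNReal.ofReal_sum_of_nonneg fun i _ => by positivity]
        refine Finset.sum_congr rfl fun i _ => ENNReal.ofReal_mul (by positivity)
    _ ≤ ∫⁻ x in cube a l, ∑ i, ENNReal.ofReal ((κ * l) ^ (-(N - γs i))) *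
          ENNReal.ofReal (‖x - Matrix.toEuclideanLin (A i) y‖ ^ (-γs i)) :=
        lintegral_mono_set Set.inter_subset_left
    _ = ∑ i, ENNReal.ofReal ((κ * l) ^ (-(N - γs i))) *
          ∫⁻ x in cube a l, ENNReal.ofReal (‖x - Matrix.toEuclideanLin (A i) y‖ ^ (-γs i)) := by
        rw [lintegral_finsetSum _ fun i _ => by fun_prop]
        refine Finset.sum_congr rfl fun i _ => lintegral_const_mul' _ _ (by simp)
    _ ≤ ∑ i, ENNReal.ofReal ((κ * l) ^ (-(N - γs i))) *
          (C i * ENNReal.ofReal (l ^ (n - γs i))) := by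
        gcongr with i
        exact hC i a _ l hl
    _ = _ := by
        rw [ENNReal.ofNNReal_finsetSum, Finset.sum_mul]
        refine Finset.sum_congr rfl fun i _ => ?_
        have h : (κ * l) ^ (-(N - γs i)) * l ^ (n - γs i) =
            κ ^ (-(N - γs i)) * l ^ (n - N) := by
          rw [Real.mul_rpow hκ.le hl.le, mul_assoc, ← Real.rpow_add hl]
          congr 2
          ring
        rw [ENNReal.coe_mul]
        change _ = ENNReal.ofReal _ * _ * _
        calc _ = C i * (ENNReal.ofReal ((κ * l) ^ (-(N - γs i))) *
                ENNReal.ofReal (l ^ (n - γs i))) := by ring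
          _ = C i * (ENNReal.ofReal (κ ^ (-(N - γs i))) * ENNReal.ofReal (l ^ (n - N))) := by
              rw [← ENNReal.ofReal_mul (by positivity), h, ENNReal.ofReal_mul (by positivity)]
          _ = _ := by ring

/-! ### Local and global estimates on a cube -/

/-- The infimum over a cube of the transformed fractional maximal function. -/
noncomputable def infFracMax {n : ℕ} (γ : ℝ) (f : EuclideanSpace ℝ (Fin n) → ℝ)
    (M : Matrix (Fin n) (Fin n) ℝ) (Q : Set (EuclideanSpace ℝ (Fin n))) : ℝ≥0∞ :=
  ⨅ y ∈ Q, fracMax γ f (Matrix.toEuclideanLin M⁻¹ y)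

/-- The ball of radius `B ρ` about `M⁻¹ x₀` contains both the domain of integration and `M⁻¹ z` for
every `z ∈ Q`, so the fractional maximal function may be evaluated at any such point. -/
theorem setLIntegral_le_infFracMax {n : ℕ} {γ : ℝ} (f : EuclideanSpace ℝ (Fin n) → ℝ)
    {M : Matrix (Fin n) (Fin n) ℝ} (hM : IsUnit M) {B : ℝ} (hB : 0 < B)
    (hMB : ∀ y, ‖Matrix.toEuclideanLin M⁻¹ y‖ ≤ B * ‖y‖)
    {Q : Set (EuclideanSpace ℝ (Fin n))} {x₀ : EuclideanSpace ℝ (Fin n)} {ρ : ℝ} (hρ : 0 < ρ)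
    (hQ : ∀ z ∈ Q, ‖z - x₀‖ ≤ ρ) :
    ∫⁻ y in {y | ‖x₀ - Matrix.toEuclideanLin M y‖ < ρ}, ‖f y‖ₑ ≤
      ENNReal.ofReal (ρ ^ (n * (1 - γ))) *
        (ENNReal.ofReal ((2 * B) ^ (n * (1 - γ))) * infFracMax γ f M Q) := by
  have hc : 0 < (2 * (B * ρ)) ^ (n * (1 - γ)) := by positivity
  have h : ∀ z ∈ Q, ∫⁻ y in {y | ‖x₀ - Matrix.toEuclideanLin M y‖ < ρ}, ‖f y‖ₑ ≤
      ENNReal.ofReal ((2 * (B * ρ)) ^ (n * (1 - γ))) *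
        fracMax γ f (Matrix.toEuclideanLin M⁻¹ z) := by
    intro z hz
    refine setLIntegral_le_fracMax γ f (b := Matrix.toEuclideanLin M⁻¹ x₀) (by positivity)
      (fun y hy => ?_) ?_
    · have e := hMB (Matrix.toEuclideanLin M y - x₀)
      rw [map_sub, toEuclideanLin_inv_apply_self hM, norm_sub_rev _ x₀] at e
      exact e.trans (mul_le_mul_of_nonneg_left (le_of_lt hy) hB.le)
    · rw [← map_sub]
      exact (hMB _).trans (mul_le_mul_of_nonneg_left (hQ z hz) hB.le)
  -- Dividing by the positive finite constant lets the bound, uniform in `z`, pass to the infimum.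
  rw [← mul_assoc, ← ENNReal.ofReal_mul (by positivity), ← Real.mul_rpow hρ.le (by positivity),
    show ρ * (2 * B) = 2 * (B * ρ) by ring, mul_comm, ← ENNReal.div_le_iff_le_mul (by simp [hc])
    (by simp)]
  refine le_iInf₂ fun z hz => ?_
  rw [ENNReal.div_le_iff_le_mul (by simp [hc]) (by simp), mul_comm]
  exact h z hz

/-- The points whose image under some `A i` is within `r` of `x₀`. -/
def nearSet {n m : ℕ} (A : Fin m → Matrix (Fin n) (Fin n) ℝ)
    (x₀ : EuclideanSpace ℝ (Fin n)) (r : ℝ) : Set (EuclideanSpace ℝ (Fin n)) :=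
  ⋃ i, {y | ‖x₀ - Matrix.toEuclideanLin (A i) y‖ < r}

theorem measurable_norm_const_sub_toEuclideanLin {n : ℕ} (M : Matrix (Fin n) (Fin n) ℝ)
    (x₀ : EuclideanSpace ℝ (Fin n)) : Measurable fun y => ‖x₀ - Matrix.toEuclideanLin M y‖ :=
  (continuous_const.sub (continuous_toEuclideanLin M)).norm.measurable

theorem measurableSet_nearSet {n m : ℕ} (A : Fin m → Matrix (Fin n) (Fin n) ℝ)
    (x₀ : EuclideanSpace ℝ (Fin n)) (r : ℝ) : MeasurableSet (nearSet A x₀ r) :=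
  MeasurableSet.iUnion fun i =>
    measurableSet_lt (measurable_norm_const_sub_toEuclideanLin (A i) x₀) measurable_const

theorem setLIntegral_nearSet_le {n m : ℕ} {A : Fin m → Matrix (Fin n) (Fin n) ℝ}
    (hA : ∀ i, IsUnit (A i)) {γ : ℝ} (f : EuclideanSpace ℝ (Fin n) → ℝ) {B : ℝ} (hB : 0 < B)
    (hAB : ∀ i y, ‖Matrix.toEuclideanLin (A i)⁻¹ y‖ ≤ B * ‖y‖)
    {Q : Set (EuclideanSpace ℝ (Fin n))} {x₀ : EuclideanSpace ℝ (Fin n)} {ρ : ℝ} (hρ : 0 < ρ)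
    (hQ : ∀ z ∈ Q, ‖z - x₀‖ ≤ ρ) :
    ∫⁻ y in nearSet A x₀ ρ, ‖f y‖ₑ ≤ ENNReal.ofReal (ρ ^ (n * (1 - γ))) *
      (ENNReal.ofReal ((2 * B) ^ (n * (1 - γ))) * ∑ i, infFracMax γ f (A i) Q) := by
  refine (lintegral_iUnion_le _ _).trans ?_
  rw [tsum_fintype, Finset.mul_sum, Finset.mul_sum]
  exact Finset.sum_le_sum fun i _ => setLIntegral_le_infFracMax f (hA i) hB (hAB i) hρ hQ

/-- The contribution of the points far from a cube varies little on the cube. -/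
theorem setLIntegral_compl_nearSet_le {n m : ℕ} (hm : 0 < m)
    {A : Fin m → Matrix (Fin n) (Fin n) ℝ} (hA : ∀ i, IsUnit (A i)) {γ : ℝ}
    {γs : Fin m → ℝ} (hγs : ∀ i, 0 ≤ γs i) (hsum : ∑ i, γs i = n * (1 - γ))
    {f : EuclideanSpace ℝ (Fin n) → ℝ} (hf : AEMeasurable f volume) {B : ℝ} (hB : 0 < B)
    (hAB : ∀ i y, ‖Matrix.toEuclideanLin (A i)⁻¹ y‖ ≤ B * ‖y‖)
    {Q : Set (EuclideanSpace ℝ (Fin n))} {x x₀ : EuclideanSpace ℝ (Fin n)} {R : ℝ} (hR : 0 < R)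
    (hQ : ∀ z ∈ Q, ‖z - x₀‖ ≤ R) (hx : x ∈ Q) :
    ∫⁻ y in (nearSet A x₀ (2 * R))ᶜ, ‖homKernel A γs x y - homKernel A γs x₀ y‖ₑ * ‖f y‖ₑ ≤
      ENNReal.ofReal (2 * (∑ i, γs i) * Real.exp (∑ i, γs i) * 2 ^ (∑ i, γs i) *
        (2 * B) ^ (∑ i, γs i)) * ∑ i, infFracMax γ f (A i) Q := by
  have : Nonempty (Fin m) := ⟨⟨0, hm⟩⟩
  set N := ∑ i, γs i with hN
  have hN0 : 0 ≤ N := Finset.sum_nonneg fun i _ => hγs i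
  set d : Fin m → EuclideanSpace ℝ (Fin n) → ℝ :=
    fun i y => ‖x₀ - Matrix.toEuclideanLin (A i) y‖ with hd
  have hdm : ∀ i, Measurable (d i) := fun i => measurable_norm_const_sub_toEuclideanLin (A i) x₀
  have hfar : ∀ y ∈ (nearSet A x₀ (2 * R))ᶜ, ∀ i, 2 * R ≤ d i y := by
    intro y hy i
    by_contra! h
    exact hy (Set.mem_iUnion.2 ⟨i, h⟩)
  have htail : ∀ i, ∫⁻ y in (nearSet A x₀ (2 * R))ᶜ,
      ENNReal.ofReal (d i y ^ (-(N + 1))) * ‖f y‖ₑ ≤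
      ENNReal.ofReal (2 ^ (N + 1) * (2 * R)⁻¹) *
        (ENNReal.ofReal ((2 * B) ^ N) * infFracMax γ f (A i) Q) := by
    intro i
    refine le_trans (lintegral_mono_set fun y hy => hfar y hy i) ?_
    refine lintegral_rpow_tail_le (hdm i) hf.enorm hN0 (by positivity) fun ρ hρ => ?_
    rw [hsum]
    exact setLIntegral_le_infFracMax f (hA i) hB (hAB i) (by linarith)
      fun z hz => (hQ z hz).trans (by linarith)
  calc ∫⁻ y in (nearSet A x₀ (2 * R))ᶜ, ‖homKernel A γs x y - homKernel A γs x₀ y‖ₑ * ‖f y‖ₑ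
      ≤ ∫⁻ y in (nearSet A x₀ (2 * R))ᶜ, ENNReal.ofReal (2 * N * Real.exp N * R) *
          ∑ i, ENNReal.ofReal (d i y ^ (-(N + 1))) * ‖f y‖ₑ := by
        refine setLIntegral_mono' (measurableSet_nearSet A x₀ _).compl fun y hy => ?_
        have h := abs_prod_rpow_sub_le (d := fun i => d i y)
          (e := fun i => ‖x - Matrix.toEuclideanLin (A i) y‖) hγs hR (hfar y hy) fun i =>
            (abs_norm_sub_norm_le _ _).trans (by simpa [hd] using hQ x hx)
        rw [← Finset.sum_mul, ← mul_assoc, Real.enorm_eq_ofReal_abs]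
        refine mul_le_mul' ((ENNReal.ofReal_le_ofReal h).trans (le_of_eq ?_)) le_rfl
        rw [ENNReal.ofReal_mul (by positivity),
          ENNReal.ofReal_sum_of_nonneg fun i _ => Real.rpow_nonneg (norm_nonneg _) _]
    _ = ENNReal.ofReal (2 * N * Real.exp N * R) * ∑ i, ∫⁻ y in (nearSet A x₀ (2 * R))ᶜ,
          ENNReal.ofReal (d i y ^ (-(N + 1))) * ‖f y‖ₑ := by
        rw [lintegral_const_mul' _ _ (by simp), lintegral_finsetSum' _ fun i _ => ?_]
        exact (((hdm i).pow_const _).ennreal_ofReal.aemeasurable).mul hf.enorm.restrict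
    _ ≤ ENNReal.ofReal (2 * N * Real.exp N * R) * ∑ i, ENNReal.ofReal (2 ^ (N + 1) * (2 * R)⁻¹) *
          (ENNReal.ofReal ((2 * B) ^ N) * infFracMax γ f (A i) Q) := by
        gcongr with i
        exact htail i
    -- The `R` from the kernel difference cancels the `(2R)⁻¹` from the tail, so the constant is
    -- independent of the size of the cube.
    _ = _ := by
        rw [← Finset.mul_sum, ← Finset.mul_sum, ← mul_assoc, ← mul_assoc,
          ← ENNReal.ofReal_mul (by positivity), ← ENNReal.ofReal_mul (by positivity)]
        congr 2
        rw [Real.rpow_add_one two_ne_zero]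
        field_simp

/-- Freezing the kernel at `x₀` off `S` exploits cancellation only for far points; the near part is
estimated by absolute values. -/
theorem enorm_homOp_sub_le {n m : ℕ} (A : Fin m → Matrix (Fin n) (Fin n) ℝ) (γs : Fin m → ℝ)
    {f : EuclideanSpace ℝ (Fin n) → ℝ} {x x₀ : EuclideanSpace ℝ (Fin n)}
    (hx : Integrable (fun y => homKernel A γs x y * f y) volume)
    (hx₀ : Integrable (fun y => homKernel A γs x₀ y * f y) volume)
    {S : Set (EuclideanSpace ℝ (Fin n))} (hS : MeasurableSet S) :
    ‖homOp A γs f x - ∫ y in Sᶜ, homKernel A γs x₀ y * f y‖ₑ ≤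
      (∫⁻ y in S, ENNReal.ofReal (homKernel A γs x y) * ‖f y‖ₑ) +
      ∫⁻ y in Sᶜ, ‖homKernel A γs x y - homKernel A γs x₀ y‖ₑ * ‖f y‖ₑ := by
  have e : homOp A γs f x - ∫ y in Sᶜ, homKernel A γs x₀ y * f y =
      (∫ y in S, homKernel A γs x y * f y) +
        ∫ y in Sᶜ, (homKernel A γs x y - homKernel A γs x₀ y) * f y := by
    simp_rw [sub_mul]
    rw [homOp, ← integral_add_compl hS hx, integral_sub hx.restrict hx₀.restrict]
    ring
  rw [e]
  refine (enorm_add_le _ _).trans (add_le_add ?_ ?_)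
  · refine (enorm_integral_le_lintegral_enorm _).trans (le_of_eq ?_)
    refine lintegral_congr fun y => ?_
    rw [enorm_mul, Real.enorm_eq_ofReal (homKernel_nonneg A γs x y)]
  · refine (enorm_integral_le_lintegral_enorm _).trans (le_of_eq ?_)
    exact lintegral_congr fun y => enorm_mul _ _

theorem aemeasurable_homKernel_mul {n m : ℕ} (A : Fin m → Matrix (Fin n) (Fin n) ℝ)
    (γs : Fin m → ℝ) {f : EuclideanSpace ℝ (Fin n) → ℝ} (hf : AEMeasurable f volume)
    (S T : Set (EuclideanSpace ℝ (Fin n))) :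
    AEMeasurable (Function.uncurry fun x y => ENNReal.ofReal (homKernel A γs x y) * ‖f y‖ₑ)
      ((volume.restrict T).prod (volume.restrict S)) :=
  (measurable_homKernel A γs).ennreal_ofReal.aemeasurable.mul
    (hf.enorm.restrict.comp_snd)

/-- Tonelli: the kernel is integrated in `x` first, where its bound does not depend on `y`. -/
theorem lintegral_lintegral_homKernel_le {n m : ℕ} (A : Fin m → Matrix (Fin n) (Fin n) ℝ)
    (γs : Fin m → ℝ) {f : EuclideanSpace ℝ (Fin n) → ℝ} (hf : AEMeasurable f volume)
    (S T : Set (EuclideanSpace ℝ (Fin n))) {K : ℝ≥0∞}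
    (hK : ∀ y, ∫⁻ x in T, ENNReal.ofReal (homKernel A γs x y) ≤ K) :
    ∫⁻ x in T, ∫⁻ y in S, ENNReal.ofReal (homKernel A γs x y) * ‖f y‖ₑ ≤
      K * ∫⁻ y in S, ‖f y‖ₑ := by
  rw [lintegral_lintegral_swap (aemeasurable_homKernel_mul A γs hf S T),
    ← lintegral_const_mul'' _ hf.enorm.restrict]
  refine lintegral_mono fun y => ?_
  rw [lintegral_mul_const' _ _ (by simp)]
  gcongr
  exact hK y

/-- Strict levels suffice for an infimum. They guarantee `α > 0`, needed in Markov's inequality, and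
leave nothing to check when `b = ∞`. -/
theorem medianOsc_le_of_forall_gt {n : ℕ} {s : ℝ} {g : EuclideanSpace ℝ (Fin n) → ℝ}
    {Q : Set (EuclideanSpace ℝ (Fin n))} (c : ℝ) {b : ℝ≥0∞}
    (h : ∀ α : ℝ≥0, b < α →
      volume {y | y ∈ Q ∧ (α : ℝ) < |g y - c|} < ENNReal.ofReal s * volume Q) :
    medianOsc s g Q ≤ b := by
  refine le_of_forall_gt fun t ht => ?_
  obtain ⟨α, h1, h2⟩ := ENNReal.lt_iff_exists_nnreal_btwn.1 ht
  exact (iInf₂_le_of_le c α (iInf_le_of_le (h α h1) le_rfl)).trans_lt h2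

/-- The exceptional set in `Q` is covered by a null set, a small ball about the origin, and a
superlevel set of the near part; the last two have measure at most `s|Q|/4` each. -/
theorem medianOsc_homOp_le {n m : ℕ} (hn : 0 < n) (hm : 0 < m)
    {A : Fin m → Matrix (Fin n) (Fin n) ℝ} (hA : ∀ i, IsUnit (A i))
    (hAA : ∀ k k', k ≠ k' → IsUnit (A k - A k')) {γ : ℝ}
    {γs : Fin m → ℝ} (hγs : ∀ i, 0 ≤ γs i) (hγn : ∀ i, γs i < n)
    (hsum : ∑ i, γs i = n * (1 - γ)) {s : ℝ} (hs0 : 0 < s) (hs1 : s ≤ 1) :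
    ∃ c : ℝ≥0, ∀ f : EuclideanSpace ℝ (Fin n) → ℝ, AEMeasurable f volume →
      (∀ᵐ x, Integrable (fun y => homKernel A γs x y * f y) volume) →
      ∀ Q, IsCube Q → medianOsc s (homOp A γs f) Q ≤ c * ∑ i, infFracMax γ f (A i) Q := by
  obtain ⟨B, hB, hAB⟩ := exists_norm_toEuclideanLin_le fun i => (A i)⁻¹
  -- The ball of radius `s l / 8` has measure at most `(s/4)^n l^n ≤ (s/4) l^n`.
  obtain ⟨C₁, hC₁⟩ := lintegral_homKernel_le hn hm A hAA γs hγs hγn (ε := s / 8) (by positivity)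
  set N := ∑ i, γs i with hN
  set C₂ : ℝ≥0∞ := ENNReal.ofReal (2 * N * Real.exp N * 2 ^ N * (2 * B) ^ N) with hC₂
  set C₃ : ℝ≥0∞ := C₁ * ENNReal.ofReal ((2 * √n) ^ N * (2 * B) ^ N) with hC₃
  -- For `α > c X`, the first term gives `C₂ X ≤ α/2` for the far part, and the second gives `C₃ X ≤
  -- (s/8) α`, so Markov at level `α/2` yields `s/4`.
  set c : ℝ≥0∞ := 2 * C₂ + ENNReal.ofReal (8 / s) * C₃ with hc
  have hctop : c ≠ ∞ := by simp [hc, hC₂, hC₃, ENNReal.mul_eq_top]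
  refine ⟨c.toNNReal, fun f hf hfint Q hQ => ?_⟩
  rw [ENNReal.coe_toNNReal hctop]
  obtain ⟨a, l, hl, rfl⟩ := hQ
  change medianOsc s _ (cube a l) ≤ c * ∑ i, infFracMax γ f (A i) (cube a l)
  set X := ∑ i, infFracMax γ f (A i) (cube a l) with hX
  have hn' : (0 : ℝ) < n := by exact_mod_cast hn
  have hR : 0 < √n * l := by positivity
  have hvol : volume (cube a l) = ENNReal.ofReal (l ^ n) := volume_cube a hl.le
  obtain ⟨x₀, hx₀Q, hx₀⟩ : ∃ x₀ ∈ cube a l,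
      Integrable (fun y => homKernel A γs x₀ y * f y) volume := by
    by_contra! hcon
    have h0 : volume (cube a l) = 0 := measure_mono_null (fun x hx => hcon x hx) hfint
    rw [hvol] at h0
    have : 0 < l ^ n := by positivity
    simp only [ENNReal.ofReal_eq_zero] at h0
    linarith
  have hQR : ∀ z ∈ cube a l, ‖z - x₀‖ ≤ √n * l := fun z hz =>
    norm_sub_le_of_mem_cube hl.le hz hx₀Q
  set S := nearSet A x₀ (2 * (√n * l)) with hS
  set U : EuclideanSpace ℝ (Fin n) → ℝ≥0∞ :=
    fun x => ∫⁻ y in S, ENNReal.ofReal (homKernel A γs x y) * ‖f y‖ₑ with hU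
  set T := cube a l ∩ {x | s / 8 * l ≤ ‖x‖} with hT
  have hTm : MeasurableSet T := (measurableSet_cube a l).inter
    (measurableSet_le measurable_const measurable_norm)
  have hUm : AEMeasurable U (volume.restrict T) :=
    (aemeasurable_homKernel_mul A γs hf S T).lintegral_prod_right'
  have hUint : ∫⁻ x in T, U x ≤ ENNReal.ofReal (l ^ n) * (C₃ * X) := by
    refine (lintegral_lintegral_homKernel_le A γs hf S T fun y => hC₁ a y l hl).trans ?_
    have h := setLIntegral_nearSet_le (γ := γ) hA f hB hAB (ρ := 2 * (√n * l)) (by positivity)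
      fun z hz => (hQR z hz).trans (by linarith)
    rw [← hsum] at h
    calc _ ≤ C₁ * ENNReal.ofReal (l ^ (n - N)) * (ENNReal.ofReal ((2 * (√n * l)) ^ N) *
          (ENNReal.ofReal ((2 * B) ^ N) * X)) := by gcongr
      _ = C₁ * (ENNReal.ofReal (l ^ (n - N)) * ENNReal.ofReal ((2 * (√n * l)) ^ N) *
          ENNReal.ofReal ((2 * B) ^ N)) * X := by ring
      _ = C₁ * (ENNReal.ofReal (l ^ n) * ENNReal.ofReal ((2 * √n) ^ N * (2 * B) ^ N)) * X := by
          rw [← ENNReal.ofReal_mul (by positivity), ← ENNReal.ofReal_mul (by positivity),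
            ← ENNReal.ofReal_mul (by positivity)]
          congr 3
          rw [← mul_assoc 2, Real.mul_rpow (by positivity) hl.le, ← Real.rpow_natCast l n,
            Real.rpow_sub hl]
          field_simp
      _ = _ := by rw [hC₃]; ring
  refine medianOsc_le_of_forall_gt (∫ y in Sᶜ, homKernel A γs x₀ y * f y) fun α hα => ?_
  have hα0 : (0 : ℝ≥0∞) < α := (zero_le).trans_lt hα
  set Z := {x | ¬ Integrable (fun y => homKernel A γs x y * f y) volume} with hZ
  have hsub : {y | y ∈ cube a l ∧ (α : ℝ) <
      |homOp A γs f y - ∫ y in Sᶜ, homKernel A γs x₀ y * f y|} ⊆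
      Z ∪ {x | ‖x - 0‖ < s / 8 * l} ∪ (T ∩ {x | (α : ℝ≥0∞) / 2 ≤ U x}) := by
    rintro x ⟨hxQ, hxα⟩
    by_cases h1 : Integrable (fun y => homKernel A γs x y * f y) volume
    swap
    · exact Or.inl (Or.inl h1)
    by_cases h2 : ‖x‖ < s / 8 * l
    · exact Or.inl (Or.inr (by simpa using h2))
    refine Or.inr ⟨⟨hxQ, not_lt.1 h2⟩, ?_⟩
    change (α : ℝ≥0∞) / 2 ≤ U x
    by_contra! h3
    have h4 := enorm_homOp_sub_le A γs h1 hx₀ (measurableSet_nearSet A x₀ (2 * (√n * l)))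
    have h5 := setLIntegral_compl_nearSet_le hm hA hγs hsum hf hB hAB hR hQR hxQ
    have h6 : C₂ * X ≤ α / 2 := by
      rw [ENNReal.le_div_iff_mul_le (by simp) (by simp)]
      refine le_trans ?_ hα.le
      calc C₂ * X * 2 = 2 * C₂ * X := by ring
        _ ≤ c * X := by gcongr; exact le_self_add
    have h7 : (α : ℝ≥0∞) < ‖homOp A γs f x - ∫ y in Sᶜ, homKernel A γs x₀ y * f y‖ₑ := by
      rw [enorm_eq_nnnorm]
      exact_mod_cast hxα
    have h8 : (α : ℝ≥0∞) < α := by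
      calc (α : ℝ≥0∞) < _ := h7
        _ ≤ U x + C₂ * X := h4.trans (add_le_add_right h5 _)
        _ ≤ α / 2 + α / 2 := add_le_add h3.le h6
        _ = α := ENNReal.add_halves _
    exact lt_irrefl _ h8
  have hv1 : volume Z = 0 := hfint
  have hv2 : volume {x : EuclideanSpace ℝ (Fin n) | ‖x - 0‖ < s / 8 * l} ≤
      ENNReal.ofReal (s / 4 * l ^ n) := by
    refine (volume_ball_le 0 (by positivity)).trans (ENNReal.ofReal_le_ofReal ?_)
    rw [show 2 * (s / 8 * l) = s / 4 * l by ring, mul_pow]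
    gcongr
    exact pow_le_of_le_one (by positivity) (by linarith) hn.ne'
  have hv3 : volume (T ∩ {x | (α : ℝ≥0∞) / 2 ≤ U x}) ≤ ENNReal.ofReal (s / 4 * l ^ n) := by
    have h1 := mul_meas_ge_le_lintegral₀ hUm (α / 2)
    rw [Measure.restrict_apply₀'  hTm.nullMeasurableSet, Set.inter_comm] at h1
    have hα2 : (α : ℝ≥0∞) / 2 ≠ 0 := (ENNReal.half_pos hα0.ne').ne'
    have hα2' : (α : ℝ≥0∞) / 2 ≠ ∞ := (ENNReal.div_lt_top (by simp) (by simp)).ne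
    rw [← ENNReal.mul_le_mul_iff_right hα2 hα2']
    have h2 : C₃ * X ≤ ENNReal.ofReal (s / 8) * α := by
      calc C₃ * X = ENNReal.ofReal (s / 8) * (ENNReal.ofReal (8 / s) * C₃ * X) := by
            rw [← mul_assoc, ← mul_assoc, ← ENNReal.ofReal_mul (by positivity),
              show s / 8 * (8 / s) = 1 by field_simp]
            simp
        _ ≤ ENNReal.ofReal (s / 8) * (c * X) := by gcongr; exact le_add_self
        _ ≤ _ := by gcongr
    calc _ ≤ ENNReal.ofReal (l ^ n) * (C₃ * X) := h1.trans hUint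
      _ ≤ ENNReal.ofReal (l ^ n) * (ENNReal.ofReal (s / 8) * α) := by gcongr
      _ = ENNReal.ofReal (l ^ n) * ENNReal.ofReal (s / 8) * (α / 2 + α / 2) := by
          rw [ENNReal.add_halves, mul_assoc]
      _ = (α / 2) * (ENNReal.ofReal 2 * (ENNReal.ofReal (l ^ n) * ENNReal.ofReal (s / 8))) := by
          rw [ENNReal.ofReal_ofNat]; ring
      _ = _ := by
          rw [← ENNReal.ofReal_mul (by positivity), ← ENNReal.ofReal_mul (by positivity)]
          congr 2
          ring
  calc _ ≤ volume Z + volume {x : EuclideanSpace ℝ (Fin n) | ‖x - 0‖ < s / 8 * l} +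
        volume (T ∩ {x | (α : ℝ≥0∞) / 2 ≤ U x}) :=
        (measure_mono hsub).trans ((measure_union_le _ _).trans
          (add_le_add_left (measure_union_le _ _) _))
    _ ≤ 0 + ENNReal.ofReal (s / 4 * l ^ n) + ENNReal.ofReal (s / 4 * l ^ n) := by
        rw [hv1]; gcongr
    _ = ENNReal.ofReal (s / 2 * l ^ n) := by
        rw [zero_add, ← ENNReal.ofReal_add (by positivity) (by positivity)]
        congr 1
        ring
    _ < ENNReal.ofReal (s * l ^ n) := by
        have : 0 < l ^ n := by positivity
        refine (ENNReal.ofReal_lt_ofReal_iff (by positivity)).2 ?_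
        nlinarith
    _ = _ := by rw [hvol, ENNReal.ofReal_mul hs0.le]

/-! ### The critical exponent -/

theorem ae_comp_toEuclideanLin {n : ℕ} {M : Matrix (Fin n) (Fin n) ℝ} (hM : IsUnit M)
    {p : EuclideanSpace ℝ (Fin n) → Prop} (hp : ∀ᵐ x, p x) :
    ∀ᵐ y, p (Matrix.toEuclideanLin M y) := by
  refine measure_mono_null (t := Matrix.toEuclideanLin M⁻¹ '' {x | ¬ p x})
    (fun y hy => ⟨_, hy, toEuclideanLin_inv_apply_self hM y⟩) ?_
  rw [Measure.addHaar_image_linearMap, show volume {x | ¬ p x} = 0 from hp, mul_zero]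

theorem norm_le_pow_mul_norm_rpow_mul {n : ℕ} {t D c : ℝ} (ht : 0 < t) (htD : t ≤ D) :
    ‖c‖ ≤ D ^ n * ‖t ^ (-(n : ℝ)) * c‖ := by
  rw [norm_mul, Real.rpow_neg ht.le, Real.rpow_natCast, norm_inv, norm_pow,
    Real.norm_of_nonneg ht.le, ← mul_assoc]
  refine le_mul_of_one_le_left (norm_nonneg _) ?_
  rw [← div_eq_mul_inv, one_le_div (by positivity)]
  gcongr

/-- If `|x - M y|⁻ⁿ f(y)` is integrable for almost every `x`, then `f` vanishes. -/
theorem ae_eq_zero_of_integrable_norm_rpow_mul {n : ℕ} (hn : 0 < n)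
    {M : Matrix (Fin n) (Fin n) ℝ} (hM : IsUnit M) {f : EuclideanSpace ℝ (Fin n) → ℝ}
    (hf : AEMeasurable f volume)
    (hint : ∀ᵐ x, Integrable
      (fun y => ‖x - Matrix.toEuclideanLin M y‖ ^ (-(n : ℝ)) * f y) volume) :
    f =ᵐ[volume] 0 := by
  have : Nonempty (Fin n) := ⟨⟨0, hn⟩⟩
  obtain ⟨B, hB, hMB⟩ := exists_norm_toEuclideanLin_le fun _ : Unit => M
  replace hMB := hMB ()
  have hbound : ∀ (x : EuclideanSpace ℝ (Fin n)) (D : ℝ), ∀ᵐ y,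
      ‖x - Matrix.toEuclideanLin M y‖ ≤ D →
      ‖f y‖ ≤ D ^ n * ‖‖x - Matrix.toEuclideanLin M y‖ ^ (-(n : ℝ)) * f y‖ := by
    intro x D
    -- At this point the weight is `0 ^ (-n) = 0` by convention, and the bound could fail.
    have hne : ∀ᵐ y, y ≠ Matrix.toEuclideanLin M⁻¹ x := by
      simp [ae_iff]
    filter_upwards [hne] with y hy hD
    refine norm_le_pow_mul_norm_rpow_mul (norm_pos_iff.2 (sub_ne_zero.2 ?_)) hD
    rintro rfl
    exact hy (toEuclideanLin_inv_apply_self hM y).symm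
  -- Convergence at a single `x` suffices, since the weight is bounded below on bounded sets.
  have hloc : LocallyIntegrable f volume := by
    obtain ⟨x, hx⟩ := hint.exists
    intro z
    refine ⟨Metric.ball z 1, Metric.ball_mem_nhds z one_pos, ?_⟩
    refine Integrable.mono' ((hx.norm.const_mul ((‖x‖ + B * (‖z‖ + 1)) ^ n)).restrict)
      hf.aestronglyMeasurable.restrict ?_
    filter_upwards [ae_restrict_mem measurableSet_ball,
      ae_restrict_of_ae (hbound x (‖x‖ + B * (‖z‖ + 1)))] with y hy h
    refine h ((norm_sub_le _ _).trans ?_)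
    gcongr
    refine (hMB y).trans ?_
    gcongr
    have h1 : ‖y - z‖ < 1 := by simpa [dist_eq_norm] using hy
    have h2 := norm_add_le z (y - z)
    rw [add_sub_cancel] at h2
    linarith
  filter_upwards [IsUnifLocDoublingMeasure.ae_tendsto_average volume hloc 1,
    ae_comp_toEuclideanLin hM hint] with x hx hxint
  set φ := fun y => ‖Matrix.toEuclideanLin M x - Matrix.toEuclideanLin M y‖ ^ (-(n : ℝ)) * f y
    with hφ
  have hδ : Filter.Tendsto (fun k : ℕ => 1 / ((k : ℝ) + 1)) Filter.atTop (nhdsWithin 0 (Set.Ioi 0)) :=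
    tendsto_nhdsWithin_iff.2 ⟨tendsto_one_div_add_atTop_nhds_zero_nat,
      Filter.Eventually.of_forall fun k => by simp only [Set.mem_Ioi]; positivity⟩
  have hδ0 : ∀ k : ℕ, 0 < 1 / ((k : ℝ) + 1) := fun k => by positivity
  have hav := hx (fun _ : ℕ => x) _ hδ
    (Filter.Eventually.of_forall fun k => Metric.mem_closedBall_self (by positivity))
  have hball : ∀ k : ℕ, volume.real (Metric.closedBall x (1 / ((k : ℝ) + 1))) =
      (1 / ((k : ℝ) + 1)) ^ n * volume.real (Metric.ball (0 : EuclideanSpace ℝ (Fin n)) 1) := by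
    intro k
    rw [Measure.addHaar_real_closedBall _ _ (hδ0 k).le, finrank_euclideanSpace, Fintype.card_fin]
  have hball' : Filter.Tendsto
      (volume ∘ fun k : ℕ => Metric.closedBall x (1 / ((k : ℝ) + 1))) Filter.atTop (nhds 0) := by
    have h1 : Filter.Tendsto (fun k : ℕ => ENNReal.ofReal ((1 / ((k : ℝ) + 1)) ^ n *
        volume.real (Metric.ball (0 : EuclideanSpace ℝ (Fin n)) 1))) Filter.atTop (nhds 0) := by
      have h2 := ((tendsto_one_div_add_atTop_nhds_zero_nat (𝕜 := ℝ)).pow n).mul_const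
        (volume.real (Metric.ball (0 : EuclideanSpace ℝ (Fin n)) 1))
      simpa [hn.ne'] using ENNReal.tendsto_ofReal h2
    refine h1.congr fun k => ?_
    rw [← hball k, Function.comp_apply, ofReal_measureReal measure_closedBall_lt_top.ne]
  set v := volume.real (Metric.ball (0 : EuclideanSpace ℝ (Fin n)) 1) with hv
  have hv0 : 0 < v := ENNReal.toReal_pos
    (Metric.isOpen_ball.measure_pos volume (Metric.nonempty_ball.2 one_pos)).ne'
    measure_ball_lt_top.ne
  -- Averages of `f` over balls shrinking to `x` are dominated by integrals of the weighted function
  -- `φ` over these balls. Those vanish by absolute continuity, so the Lebesgue value `f x` is zero.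
  have hI := (hxint.norm.tendsto_setIntegral_nhds_zero hball').const_mul (B ^ n / v)
  rw [mul_zero] at hI
  refine tendsto_nhds_unique hav (squeeze_zero_norm (fun k => ?_) hI)
  set δ := 1 / ((k : ℝ) + 1) with hδk
  have hδp : 0 < δ := hδ0 k
  have hle : ∫ y in Metric.closedBall x δ, ‖f y‖ ≤
      ∫ y in Metric.closedBall x δ, (B * δ) ^ n * ‖φ y‖ := by
    refine setIntegral_mono_ae_restrict ?_ (hxint.norm.const_mul _).restrict ?_
    · exact (hloc.integrableOn_isCompact (isCompact_closedBall x δ)).norm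
    filter_upwards [ae_restrict_mem measurableSet_closedBall,
      ae_restrict_of_ae (hbound (Matrix.toEuclideanLin M x) (B * δ))] with y hy h
    refine h ?_
    rw [← map_sub]
    refine (hMB _).trans ?_
    gcongr
    rwa [Metric.mem_closedBall', dist_eq_norm] at hy
  rw [setAverage_eq, norm_smul, norm_inv, hball k, Real.norm_of_nonneg (by positivity)]
  calc (δ ^ n * v)⁻¹ * ‖∫ y in Metric.closedBall x δ, f y‖
      ≤ (δ ^ n * v)⁻¹ * ∫ y in Metric.closedBall x δ, (B * δ) ^ n * ‖φ y‖ := by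
        gcongr
        exact (norm_integral_le_integral_norm _).trans hle
    _ = B ^ n / v * ∫ y in Metric.closedBall x δ, ‖φ y‖ := by
        rw [integral_const_mul, mul_pow]
        field_simp

/-- Positive exponents with sum at most `n`, one of them at least `n`, leave a single factor with
exponent exactly `n`; integrability then kills `f`. -/
theorem homOp_eq_zero_of_critical {n m : ℕ} (hn : 0 < n)
    {A : Fin m → Matrix (Fin n) (Fin n) ℝ} (hA : ∀ i, IsUnit (A i))
    {γs : Fin m → ℝ} (hγs : ∀ i, 0 < γs i) (hsum : ∑ i, γs i ≤ n) {i : Fin m}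
    (hi : n ≤ γs i) {f : EuclideanSpace ℝ (Fin n) → ℝ} (hf : AEMeasurable f volume)
    (hint : ∀ᵐ x, Integrable (fun y => homKernel A γs x y * f y) volume)
    (x : EuclideanSpace ℝ (Fin n)) : homOp A γs f x = 0 := by
  classical
  have huniq : ∀ j, j = i := by
    intro j
    by_contra hj
    have h := Finset.sum_le_univ_sum_of_nonneg (s := {i, j}) fun k => (hγs k).le
    rw [Finset.sum_pair (Ne.symm hj)] at h
    linarith [hγs j]
  have huniv : (Finset.univ : Finset (Fin m)) = {i} := by
    ext j
    simp [huniq j]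
  have hγi : γs i = n := by
    rw [huniv, Finset.sum_singleton] at hsum
    exact le_antisymm hsum hi
  have hk : ∀ x y, homKernel A γs x y =
      ‖x - Matrix.toEuclideanLin (A i) y‖ ^ (-(n : ℝ)) := by
    intro x y
    rw [homKernel, huniv, Finset.prod_singleton, hγi]
  simp_rw [hk] at hint
  have hf0 := ae_eq_zero_of_integrable_norm_rpow_mul hn (hA i) hf hint
  refine integral_eq_zero_of_ae ?_
  filter_upwards [hf0] with y hy
  simp [hy]

end FracHom

/-! ### The theorem: subcritical and critical exponents -/

theorem theorem2p3 (n m : ℕ) (hn : 0 < n)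
    (A : Fin m → Matrix (Fin n) (Fin n) ℝ)
    (hA : ∀ i, IsUnit (A i))
    (hAA : ∀ k k', k ≠ k' → IsUnit (A k - A k'))
    (γ : ℝ) (hγ0 : 0 ≤ γ) (hγ1 : γ < 1)
    (γs : Fin m → ℝ) (hγs : ∀ i, 0 < γs i) (hsum : ∑ i, γs i = n * (1 - γ))
    (s : ℝ) (hs0 : 0 < s) (hs1 : s ≤ 1 / 2) :
    ∃ c : ℝ≥0, ∀ f : EuclideanSpace ℝ (Fin n) → ℝ, AEMeasurable f volume →
      (∀ᵐ x, Integrable (fun y => FracHom.homKernel A γs x y * f y) volume) →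
      ∀ Q₀ : Set (EuclideanSpace ℝ (Fin n)), FracHom.IsCube Q₀ → ∀ x ∈ Q₀,
        FracHom.localSharp s Q₀ (FracHom.homOp A γs f) x ≤
          c * ∑ i, ⨆ (Q : Set (EuclideanSpace ℝ (Fin n))) (_ : FracHom.IsCube Q) (_ : x ∈ Q)
            (_ : Q ⊆ Q₀), ⨅ y ∈ Q, FracHom.fracMax γ f (Matrix.toEuclideanLin (A i)⁻¹ y) := by
  have hn' : (0 : ℝ) < n := by exact_mod_cast hn
  have hm : 0 < m := by
    -- An empty family is impossible: its exponents sum to 0, while `n (1 - γ) > 0`.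
    rcases Nat.eq_zero_or_pos m with rfl | h
    · have : (0 : ℝ) < n * (1 - γ) := mul_pos hn' (by linarith)
      rw [Finset.univ_eq_empty, Finset.sum_empty] at hsum
      linarith
    · exact h
  have hsum' : ∑ i, γs i ≤ n := by
    rw [hsum]
    exact mul_le_of_le_one_right hn'.le (by linarith)
  by_cases hlt : ∀ i, γs i < n
  · obtain ⟨c, hc⟩ := FracHom.medianOsc_homOp_le hn hm hA hAA (fun i => (hγs i).le) hlt hsum hs0
      (by linarith)
    refine ⟨c, fun f hf hint Q₀ _ x _ => ?_⟩
    refine iSup₂_le fun Q hQ => iSup₂_le fun hxQ hQQ => (hc f hf hint Q hQ).trans ?_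
    gcongr with i
    exact le_iSup₂_of_le Q hQ (le_iSup₂_of_le hxQ hQQ le_rfl)
  · push Not at hlt
    obtain ⟨i, hi⟩ := hlt
    -- Here `Tf` is identically zero, so its level sets are empty and `c = 0` works.
    refine ⟨0, fun f hf hint Q₀ _ x _ => ?_⟩
    refine iSup₂_le fun Q hQ => iSup₂_le fun hxQ hQQ => ?_
    refine le_trans (FracHom.medianOsc_le_of_forall_gt 0 (b := 0) fun α _ => ?_) zero_le
    obtain ⟨a, l, hl, rfl⟩ := hQ
    have h0 := FracHom.homOp_eq_zero_of_critical hn hA hγs hsum' hi hf hint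
    have hset : ∀ S : Set (EuclideanSpace ℝ (Fin n)),
        {y | y ∈ S ∧ (α : ℝ) < |FracHom.homOp A γs f y - 0|} = ∅ := by
      intro S
      ext y
      simp [h0 y]
    rw [hset, measure_empty, FracHom.volume_cube a hl.le]
    exact ENNReal.mul_pos (by simpa using hs0) (by simpa using pow_pos hl n)
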